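/- Let $k,n\ge 1$ be integers and $0<H<1$. A real-valued centered Gaussian random field $b^H$ on $[0,\infty)^k$ over a probability space $(\Omega,\mathcal F,\mathbb P)$ is a fractional Brownian $(k,1)$-field with Hurst index $H$ if $b^H(0)=0$ almost surely and $\mathbb E|b^H(t)-b^H(s)|^2=|t-s|^{2H}$ for all $s,t\in[0,\infty)^k$; a fractional Brownian $(k,n)$-field is a random field $B^H=(b^H_1,\dots,b^H_n)$ with values in $\mathbb R^n$ whose components are independent fractional Brownian $(k,1)$-fields with Hurst index $H$. Let $B^H$ be a fractional Brownian $(k,n)$-field with Hurst index $H$ such that $(\omega,t)\mapsto B^H(t,\omega)$ is measurable on $\Omega\times[0,1]^k$ with respect to the $\mathbb P\otimes\mathcal L^k$-completed product $\sigma$-algebra (as is the case if almost all paths are continuous on $[0,1]^k$). For a Lebesgue measurable function $X:[0,1]^k\to\mathbb R^n$ let $\mu_X(A)=\mathcal L^k(\{t\in[0,1]^k: X(t)\in A\})$, $A\subset\mathbb R^n$ Borel, be its occupation measure; for $0<\alpha<n$ let $U^\alpha\mu_X(x)=\int_{\mathbb R^n}|x-y|^{\alpha-n}\mu_X(dy)\in[0,\infty]$,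 $x\in\mathbb R^n$ (with $|0|^{\alpha-n}:=\infty$), be its Riesz potential of order $\alpha$. If $\mu_X$ is absolutely continuous with respect to $\mathcal L^n$, one says that $X$ has local times and calls the density $L_X=d\mu_X/d\mathcal L^n$ the local time of $X$. Let $C_\infty(\mathbb R^n)$ be the space of real-valued continuous functions on $\mathbb R^n$ vanishing at infinity. (i) If $0<\alpha<n$ and $n-\frac{k}{2H}<\alpha$, then there is an event $\Omega_0\in\mathcal F$ with $\mathbb P(\Omega_0)=1$ such that for every $\omega\in\Omega_0$ the function $B^H(\cdot,\omega)$ is Lebesgue measurable on $[0,1]^k$ and $U^\alpha\mu_{B^H(\cdot,\omega)}\in C_\infty(\mathbb R^n)$. In particular, $U^\alpha\mu_{B^H(\cdot,\omega)}$ is finite everywhere and bounded for such $\omega$. (ii) If $n<\frac{k}{2H}$, then there is an event $\Omega_0\in\mathcal F$ with $\mathbb P(\Omega_0)=1$ such that for every $\omega\in\Omega_0$ the function $B^H(\cdot,\omega)$ is Lebesgue measurable on $[0,1]^k$ and has local times, and its local time $L_{B^H(\cdot,\omega)}$ has a version in $C_\infty(\mathbb R^n)$. In particular, this version is bounded for such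 $\omega$. -/

import Mathlib

open MeasureTheory ProbabilityTheory
open scoped ENNReal NNReal ZeroAtInfty

noncomputable section

/-- The closed orthant `[0,+∞)^k`, as a subset of Euclidean `k`-space. -/
def orthant (k : ℕ) : Set (EuclideanSpace ℝ (Fin k)) := {t | ∀ i, 0 ≤ t i}

/-- The closed unit cube `[0,1]^k`, as a subset of Euclidean `k`-space. -/
def unitCube (k : ℕ) : Set (EuclideanSpace ℝ (Fin k)) := {t | ∀ i, 0 ≤ t i ∧ t i ≤ 1}

theorem unitCube_subset_orthant (k : ℕ) : unitCube k ⊆ orthant k := fun _ ht i => (ht i).1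

/-- The origin of `[0,+∞)^k`. -/
def orthantZero (k : ℕ) : orthant k := ⟨0, fun _ => le_rfl⟩

/-- A real-valued random field `b` on `[0,+∞)^k` is a fractional Brownian `(k,1)`-field with Hurst
index `H` under `P`: it is a centered Gaussian field, `b 0 = 0` almost surely, and
`E |b t - b s| ^ 2 = |t - s| ^ (2 H)` with the Euclidean distance. -/
structure IsFractionalBrownianField {Ω : Type*} [MeasurableSpace Ω] {k : ℕ} (H : ℝ)
    (b : orthant k → Ω → ℝ) (P : Measure Ω) : Prop where
  isGaussianProcess : IsGaussianProcess b P
  centered : ∀ t, ∫ ω, b t ω ∂P = 0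
  zero : ∀ᵐ ω ∂P, b (orthantZero k) ω = 0
  increments : ∀ s t, ∫ ω, |b t ω - b s ω| ^ 2 ∂P = dist t s ^ (2 * H)

/-- An `ℝⁿ`-valued random field `B` on `[0,+∞)^k` is a fractional Brownian `(k,n)`-field with Hurst
index `H` under `P`: its `n` component fields are independent (as random functions on `[0,+∞)^k`,
with the product σ-algebra) fractional Brownian `(k,1)`-fields with Hurst index `H`. -/
structure IsFractionalBrownianVectorField {Ω : Type*} [MeasurableSpace Ω] {k n : ℕ} (H : ℝ)
    (B : orthant k → Ω → EuclideanSpace ℝ (Fin n)) (P : Measure Ω) : Prop where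
  component : ∀ i, IsFractionalBrownianField H (fun t ω => B t ω i) P
  indep : iIndepFun (fun (i : Fin n) (ω : Ω) (t : orthant k) => B t ω i) P

/-- The restriction to the unit cube `[0,1]^k` of the path `t ↦ B t ω`. -/
def cubePath {Ω : Type*} {k n : ℕ} (B : orthant k → Ω → EuclideanSpace ℝ (Fin n)) (ω : Ω) :
    unitCube k → EuclideanSpace ℝ (Fin n) :=
  fun t => B (Set.inclusion (unitCube_subset_orthant k) t) ω

/-- Lebesgue measure `ℒ^k` on the unit cube `[0,1]^k`. -/
def cubeVolume (k : ℕ) : Measure (unitCube k) := (volume : Measure _).comap Subtype.val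

/-- The occupation measure `A ↦ ℒ^k {t ∈ [0,1]^k | X t ∈ A}` of a function `X` on the unit cube.
(As usual for image measures, this is meaningful for almost everywhere measurable `X`.) -/
def occupationMeasure {k n : ℕ} (X : unitCube k → EuclideanSpace ℝ (Fin n)) :
    Measure (EuclideanSpace ℝ (Fin n)) :=
  (cubeVolume k).map X

/-- The Riesz kernel `|x| ^ (α - n)` of order `α` on `ℝⁿ`, with values in `[0,∞]`; for `α < n` its
value at the origin is `∞`. -/
def rieszKernel {n : ℕ} (α : ℝ) (x : EuclideanSpace ℝ (Fin n)) : ℝ≥0∞ := ‖x‖ₑ ^ (α - n)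

/-- The Riesz potential `U^α μ` of order `α` of a measure `μ` on `ℝⁿ`, with values in `[0,∞]`. -/
def rieszPotential {n : ℕ} (α : ℝ) (μ : Measure (EuclideanSpace ℝ (Fin n)))
    (x : EuclideanSpace ℝ (Fin n)) : ℝ≥0∞ :=
  ∫⁻ y, rieszKernel α (x - y) ∂μ

/-- `X` has local times: its occupation measure is absolutely continuous with respect to Lebesgue
measure on `ℝⁿ`. -/
def HasLocalTimes {k n : ℕ} (X : unitCube k → EuclideanSpace ℝ (Fin n)) : Prop :=
  occupationMeasure X ≪ volume

/-- The local time of `X`: the Radon-Nikodym density of its occupation measure with respect to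
Lebesgue measure on `ℝⁿ`, determined up to Lebesgue null sets. -/
def localTime {k n : ℕ} (X : unitCube k → EuclideanSpace ℝ (Fin n)) :
    EuclideanSpace ℝ (Fin n) → ℝ≥0∞ :=
  (occupationMeasure X).rnDeriv volume

end

/-! The proof is Fourier analytic. Let `μ` be the occupation measure of the path. Then `E |μ̂(η)|²`
is the double integral over the cube of the characteristic function of the increment at `η`, namely
`exp (-|η|² |t-s|^(2H) / 2)`. Rescaling `t - s` by `|η|^(1/H)` bounds it by a constant times
`|η|^(-k/H)`. Since also `|μ̂| ≤ μ(ℝⁿ)`, this gives `E |μ̂(η)| ≤ A min(1, |η|^(-k/(2H)))`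
(`exists_lintegral_charFun_le`). Polar coordinates and Tonelli then make `|ξ|^(-α) μ̂(ξ)` almost
surely integrable as soon as `n - k/(2H) < α < n`.

The rest is deterministic. For `0 < α < n` the Riesz potential is a constant times the inverse
Fourier transform of `|ξ|^(-α) μ̂` at every point (`rieszPotential_eq_fourierInv`); for `α = 0` the
inverse transform of `μ̂` is a density of `μ` (`exists_density_of_integrable_measureFourier`).
Inverse transforms of integrable functions are continuous and, by Riemann-Lebesgue, vanish at
infinity. A single almost sure integrability statement thus controls all points `x` at once. -/

noncomputable section

/-! ### Fourier transforms of finite measures and Gaussian smoothing. -/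

section FourierTransform

open Real Filter Topology FourierTransform

variable {V : Type*} [NormedAddCommGroup V] [InnerProductSpace ℝ V] [MeasurableSpace V]

/-- The Fourier transform `ξ ↦ ∫ exp (-2πi⟪y, ξ⟫) μ(dy)` of a measure. -/
def measureFourier (μ : Measure V) (ξ : V) : ℂ := charFun μ (-(2 * π) • ξ)

theorem measureFourier_apply (μ : Measure V) (ξ : V) :
    measureFourier μ ξ = ∫ y, Complex.exp ((-(2 * π * inner ℝ y ξ) : ℝ) * Complex.I) ∂μ := by
  simp [measureFourier, charFun_apply, inner_smul_right]

variable [BorelSpace V]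

theorem continuous_measureFourier (μ : Measure V) [IsFiniteMeasure μ] :
    Continuous (measureFourier μ) := by
  have : measureFourier μ
      = fun ξ => ∫ y, Complex.exp ((-(2 * π * inner ℝ y ξ) : ℝ) * Complex.I) ∂μ :=
    funext (measureFourier_apply μ)
  rw [this]
  refine continuous_of_dominated (bound := fun _ => 1) (fun ξ => ?_) (fun ξ => ?_)
    (integrable_const _) ?_
  · exact (by fun_prop : Continuous fun y : V =>
      Complex.exp ((-(2 * π * inner ℝ y ξ) : ℝ) * Complex.I)).aestronglyMeasurable
  · exact Eventually.of_forall fun y => (Complex.norm_exp_ofReal_mul_I _).le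
  · exact Eventually.of_forall fun y => by fun_prop

variable [FiniteDimensional ℝ V]

theorem measureFourier_withDensity {f : V → ℝ} (hf : Integrable f) (hf0 : 0 ≤ f) (ξ : V) :
    measureFourier (volume.withDensity fun x => ENNReal.ofReal (f x)) ξ
      = 𝓕 (fun x => (f x : ℂ)) ξ := by
  rw [measureFourier_apply, Real.fourier_eq',
    integral_withDensity_eq_integral_toReal_smul₀ hf.aemeasurable.ennreal_ofReal
      (Eventually.of_forall fun _ => ENNReal.ofReal_lt_top)]
  refine integral_congr_ae (Eventually.of_forall fun x => ?_)
  simp only [ENNReal.toReal_ofReal (hf0 x), smul_eq_mul, Complex.real_smul]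
  rw [mul_comm]
  congr 3
  push_cast
  ring

theorem measure_eq_of_measureFourier_eq {μ ν : Measure V} [IsFiniteMeasure μ] [IsFiniteMeasure ν]
    (h : measureFourier μ = measureFourier ν) : μ = ν := by
  refine Measure.ext_of_charFun (funext fun ξ => ?_)
  have := congrFun h ((-(2 * π))⁻¹ • ξ)
  rwa [measureFourier, measureFourier, smul_smul, mul_inv_cancel₀ (by simp [pi_ne_zero]),
    one_smul] at this

theorem integrable_gaussian {b : ℝ} (hb : 0 < b) :
    Integrable fun ξ : V => Complex.exp (-b * ‖ξ‖ ^ 2) := by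
  simpa using GaussianFourier.integrable_cexp_neg_mul_sq_norm_add (b := (b : ℂ)) (by simpa) 0 (0 : V)

omit [InnerProductSpace ℝ V] [MeasurableSpace V] [BorelSpace V] [FiniteDimensional ℝ V] in
theorem norm_gaussian (b : ℝ) (ξ : V) :
    ‖Complex.exp (-b * ‖ξ‖ ^ 2)‖ = rexp (-(b * ‖ξ‖ ^ 2)) := by
  rw [Complex.norm_exp, ← Complex.ofReal_neg, ← Complex.ofReal_pow, ← Complex.ofReal_mul,
    Complex.ofReal_re, neg_mul]

theorem continuous_fourierInv {f : V → ℂ} (hf : Integrable f) : Continuous (𝓕⁻ f) := by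
  have h : Continuous (𝓕 f) :=
    VectorFourier.fourierIntegral_continuous Real.continuous_fourierChar
      (by simpa using continuous_inner) hf
  have : 𝓕⁻ f = fun x => 𝓕 f (-x) := funext fun x => Real.fourierInv_eq_fourier_neg f x
  rw [this]
  exact h.comp continuous_neg

theorem tendsto_fourierInv_cocompact (f : V → ℂ) :
    Tendsto (𝓕⁻ f) (cocompact V) (𝓝 0) := by
  have h := tendsto_integral_exp_inner_smul_cocompact f
  have : 𝓕⁻ f = fun x => 𝓕 f (-x) := funext fun x => Real.fourierInv_eq_fourier_neg f x
  rw [this]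
  exact h.comp (Homeomorph.neg V).isClosedEmbedding.tendsto_cocompact

/-- Gaussian smoothing of a finite measure, expressed through its Fourier transform. -/
theorem integral_gaussian_eq_fourierInv (μ : Measure V) [IsFiniteMeasure μ] {b : ℝ} (hb : 0 < b)
    (x : V) :
    (((∫ y, rexp (-(π ^ 2 * ‖x - y‖ ^ 2 / b)) ∂μ : ℝ)) : ℂ)
      = ((b / π) ^ (Module.finrank ℝ V / 2 : ℝ) : ℝ)
        * 𝓕⁻ (fun ξ : V => Complex.exp (-b * ‖ξ‖ ^ 2) * measureFourier μ ξ) x := by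
  have hbc : 0 < ((b : ℂ)).re := by simpa
  have key : ∀ y : V, ∫ ξ : V, Complex.exp ((2 * π * inner ℝ ξ x : ℝ) * Complex.I) *
        (Complex.exp (-b * ‖ξ‖ ^ 2) * Complex.exp ((-(2 * π * inner ℝ y ξ) : ℝ) * Complex.I))
      = (((π / b) ^ (Module.finrank ℝ V / 2 : ℝ) : ℝ) : ℂ)
        * (rexp (-(π ^ 2 * ‖x - y‖ ^ 2 / b)) : ℝ) := by
    intro y
    -- The parameter `2πi` with vector `x - y` combines the character from the inversion at `x` with
    -- the one from `μ̂` at `y`.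
    have h := GaussianFourier.integral_cexp_neg_mul_sq_norm_add hbc (2 * π * Complex.I) (x - y)
    rw [Complex.ofReal_cpow (by positivity)]
    have e : Complex.exp ((2 * π * Complex.I) ^ 2 * ‖x - y‖ ^ 2 / (4 * b))
        = (rexp (-(π ^ 2 * ‖x - y‖ ^ 2 / b)) : ℝ) := by
      push_cast
      congr 1
      rw [mul_pow, Complex.I_sq]
      field_simp
      ring
    rw [e] at h
    push_cast at h ⊢
    rw [← h]
    refine integral_congr_ae (Eventually.of_forall fun ξ => ?_)
    simp only
    rw [← Complex.exp_add, ← Complex.exp_add]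
    congr 1
    rw [inner_sub_left, real_inner_comm ξ x]
    push_cast
    ring
  have swap := integral_integral_swap (μ := (volume : Measure V)) (ν := μ)
    (f := fun ξ y => Complex.exp ((2 * π * inner ℝ ξ x : ℝ) * Complex.I) *
        (Complex.exp (-b * ‖ξ‖ ^ 2) * Complex.exp ((-(2 * π * inner ℝ y ξ) : ℝ) * Complex.I))) (by
      have h1 := ((integrable_gaussian (V := V) hb).comp_fst μ)
      refine h1.mono ?_ (Eventually.of_forall fun p => ?_)
      · apply Continuous.aestronglyMeasurable
        simp only [Function.uncurry_def]
        fun_prop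
      · simp only [Function.uncurry_def, norm_mul, Complex.norm_exp_ofReal_mul_I, one_mul, mul_one,
          le_refl])
  have step : 𝓕⁻ (fun ξ : V => Complex.exp (-b * ‖ξ‖ ^ 2) * measureFourier μ ξ) x
      = ∫ y, (((π / b) ^ (Module.finrank ℝ V / 2 : ℝ) : ℝ) : ℂ)
        * (rexp (-(π ^ 2 * ‖x - y‖ ^ 2 / b)) : ℝ) ∂μ := by
    simp_rw [key] at swap
    rw [Real.fourierInv_eq', ← swap]
    simp_rw [measureFourier_apply, smul_eq_mul, ← integral_const_mul]
  rw [step, integral_const_mul, integral_complex_ofReal, ← mul_assoc, ← Complex.ofReal_mul,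
    ← mul_rpow (by positivity) (by positivity)]
  rw [show b / π * (π / b) = 1 by field_simp]
  simp

end FourierTransform

/-! ### Densities of measures with integrable Fourier transform. -/

section LocalTimes

open Real Filter Topology FourierTransform

variable {V : Type*} [NormedAddCommGroup V] [InnerProductSpace ℝ V] [FiniteDimensional ℝ V]
  [MeasurableSpace V] [BorelSpace V]

theorem lintegral_normalized_gaussian {b : ℝ} (hb : 0 < b) (y : V) :
    ∫⁻ x : V, ENNReal.ofReal (((b / π) ^ (Module.finrank ℝ V / 2 : ℝ))⁻¹ *
      rexp (-(π ^ 2 * ‖x - y‖ ^ 2 / b))) = 1 := by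
  have hc : 0 < π ^ 2 / b := by positivity
  have hI : Integrable fun x : V => rexp (-(π ^ 2 / b) * ‖x‖ ^ 2) := by
    have := (integrable_gaussian (V := V) hc).norm
    refine this.congr (Eventually.of_forall fun x => ?_)
    simp only [Complex.norm_exp]
    norm_cast
  have hI' : Integrable fun x : V => rexp (-(π ^ 2 * ‖x - y‖ ^ 2 / b)) := by
    refine (hI.comp_sub_right y).congr (Eventually.of_forall fun x => ?_)
    simp only
    congr 1
    ring
  rw [← ofReal_integral_eq_lintegral_ofReal (hI'.const_mul _)
    (Eventually.of_forall fun x => by positivity), integral_const_mul]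
  have e : ∫ x : V, rexp (-(π ^ 2 * ‖x - y‖ ^ 2 / b)) = (b / π) ^ (Module.finrank ℝ V / 2 : ℝ) := by
    have h := integral_sub_right_eq_self (μ := (volume : Measure V))
      (fun x : V => rexp (-(π ^ 2 / b) * ‖x‖ ^ 2)) y
    rw [GaussianFourier.integral_rexp_neg_mul_sq_norm hc] at h
    rw [show b / π = π / (π ^ 2 / b) by field_simp, ← h]
    refine integral_congr_ae (Eventually.of_forall fun x => ?_)
    simp only
    congr 1
    ring
  rw [e, inv_mul_cancel₀ (by positivity), ENNReal.ofReal_one]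

/-- Smoothing preserves the total mass whatever `b` is; this is the uniform bound that Fatou's lemma
needs as `b → 0`. -/
theorem lintegral_gaussian_smoothing (μ : Measure V) [IsFiniteMeasure μ] {b : ℝ} (hb : 0 < b) :
    ∫⁻ x : V, ENNReal.ofReal (((b / π) ^ (Module.finrank ℝ V / 2 : ℝ))⁻¹ *
      ∫ y, rexp (-(π ^ 2 * ‖x - y‖ ^ 2 / b)) ∂μ) = μ Set.univ := by
  have hI : ∀ x : V, Integrable (fun y => rexp (-(π ^ 2 * ‖x - y‖ ^ 2 / b))) μ := fun x => by
    refine Integrable.of_bound (by fun_prop) 1 (Eventually.of_forall fun y => ?_)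
    rw [norm_of_nonneg (exp_nonneg _), exp_le_one_iff, Left.neg_nonpos_iff]
    positivity
  have e : ∀ x : V, ENNReal.ofReal (((b / π) ^ (Module.finrank ℝ V / 2 : ℝ))⁻¹ *
      ∫ y, rexp (-(π ^ 2 * ‖x - y‖ ^ 2 / b)) ∂μ)
      = ∫⁻ y, ENNReal.ofReal (((b / π) ^ (Module.finrank ℝ V / 2 : ℝ))⁻¹ *
        rexp (-(π ^ 2 * ‖x - y‖ ^ 2 / b))) ∂μ := fun x => by
    rw [← ofReal_integral_eq_lintegral_ofReal ((hI x).const_mul _)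
      (Eventually.of_forall fun x => by positivity), integral_const_mul]
  simp_rw [e]
  rw [lintegral_lintegral_swap (by fun_prop)]
  simp_rw [lintegral_normalized_gaussian hb]
  simp

/-- A finite measure with integrable Fourier transform has a continuous density vanishing at
infinity. -/
theorem exists_density_of_integrable_measureFourier (μ : Measure V) [IsFiniteMeasure μ]
    (h : Integrable (measureFourier μ)) :
    ∃ f : V → ℝ, Continuous f ∧ 0 ≤ f ∧ Tendsto f (cocompact V) (𝓝 0) ∧
      μ = volume.withDensity fun x => ENNReal.ofReal (f x) := by
  set g : V → ℂ := 𝓕⁻ (measureFourier μ) with hg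
  have hgc : Continuous g := continuous_fourierInv h
  -- `p m` is `μ` mollified by a normalized Gaussian with `b = 1/(m+1)`. It is nonnegative and
  -- converges pointwise to `g`, so `g` is real and nonnegative.
  let p : ℕ → V → ℝ := fun m x => ((((m + 1 : ℝ)⁻¹) / π) ^ (Module.finrank ℝ V / 2 : ℝ))⁻¹ *
      ∫ y, rexp (-(π ^ 2 * ‖x - y‖ ^ 2 / (m + 1 : ℝ)⁻¹)) ∂μ
  have hm : ∀ m : ℕ, (0 : ℝ) < (m + 1 : ℝ)⁻¹ := fun m => by positivity
  have hp0 : ∀ m x, 0 ≤ p m x := fun m x =>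
    mul_nonneg (by positivity) (integral_nonneg fun y => (exp_nonneg _))
  have hpg : ∀ m x, (p m x : ℂ) =
      𝓕⁻ (fun ξ : V => Complex.exp (-((m + 1 : ℝ)⁻¹ : ℝ) * ‖ξ‖ ^ 2) * measureFourier μ ξ) x := by
    intro m x
    simp only [p]
    rw [Complex.ofReal_mul, integral_gaussian_eq_fourierInv μ (hm m) x, ← mul_assoc,
      ← Complex.ofReal_mul, inv_mul_cancel₀ (by have := hm m; positivity), Complex.ofReal_one,
      one_mul]
  have hlim : ∀ x, Tendsto (fun m => (p m x : ℂ)) atTop (𝓝 (g x)) := by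
    intro x
    simp_rw [hpg, hg, Real.fourierInv_eq']
    have hi : Integrable fun ξ : V =>
        Complex.exp ((2 * π * inner ℝ ξ x : ℝ) * Complex.I) • measureFourier μ ξ := by
      refine h.mono ((by fun_prop : Continuous fun ξ : V =>
        Complex.exp ((2 * π * inner ℝ ξ x : ℝ) * Complex.I)).aestronglyMeasurable.smul
          h.aestronglyMeasurable) (Eventually.of_forall fun ξ => ?_)
      rw [norm_smul, Complex.norm_exp_ofReal_mul_I, one_mul]
    have h1 := (Real.tendsto_integral_cexp_sq_smul hi).comp
      (tendsto_atTop_add_const_right atTop (1 : ℝ) tendsto_natCast_atTop_atTop)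
    refine h1.congr fun m => ?_
    simp only [Function.comp_apply, smul_eq_mul]
    refine integral_congr_ae (Eventually.of_forall fun ξ => ?_)
    simp only
    ring
  have hre : ∀ x, Tendsto (fun m => p m x) atTop (𝓝 (g x).re) := fun x => by
    simpa [Function.comp_def] using (Complex.continuous_re.tendsto _).comp (hlim x)
  have him : ∀ x, (g x).im = 0 := fun x => by
    have := (Complex.continuous_im.tendsto _).comp (hlim x)
    refine tendsto_nhds_unique this ?_
    simp [Function.comp_def]
  have hf0 : 0 ≤ fun x => (g x).re := fun x =>
    ge_of_tendsto' (hre x) fun m => hp0 m x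
  have hpm : ∀ m, Measurable (p m) := fun m => by
    have : p m = fun x => (𝓕⁻ (fun ξ : V =>
        Complex.exp (-((m + 1 : ℝ)⁻¹ : ℝ) * ‖ξ‖ ^ 2) * measureFourier μ ξ) x).re :=
      funext fun x => by rw [← hpg, Complex.ofReal_re]
    rw [this]
    refine (Complex.continuous_re.comp (continuous_fourierInv ?_)).measurable
    refine h.mono ((by fun_prop : Continuous fun ξ : V =>
      Complex.exp (-((m + 1 : ℝ)⁻¹ : ℝ) * ‖ξ‖ ^ 2)).aestronglyMeasurable.mul
        h.aestronglyMeasurable) (Eventually.of_forall fun ξ => ?_)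
    rw [norm_mul, norm_gaussian]
    refine mul_le_of_le_one_left (norm_nonneg _) ?_
    rw [exp_le_one_iff, Left.neg_nonpos_iff]
    positivity
  -- Fatou yields integrability of `g`, without which the inversion formula `𝓕 (𝓕⁻ μ̂) = μ̂` used at
  -- the end would not apply.
  have hfatou : ∫⁻ x, ENNReal.ofReal (g x).re ≤ μ Set.univ := by
    calc ∫⁻ x, ENNReal.ofReal (g x).re
        = ∫⁻ x, liminf (fun m => ENNReal.ofReal (p m x)) atTop := by
          refine lintegral_congr fun x => ?_
          exact (((ENNReal.continuous_ofReal.tendsto _).comp (hre x)).liminf_eq).symm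
      _ ≤ liminf (fun m => ∫⁻ x, ENNReal.ofReal (p m x)) atTop :=
          lintegral_liminf_le fun m => (hpm m).ennreal_ofReal
      _ = μ Set.univ := by
          simp_rw [p, lintegral_gaussian_smoothing μ (hm _)]
          simp
  have hfi : Integrable fun x => (g x).re := by
    refine ⟨(Complex.continuous_re.comp hgc).aestronglyMeasurable, ?_⟩
    rw [hasFiniteIntegral_iff_ofReal (Eventually.of_forall hf0)]
    exact hfatou.trans_lt (measure_lt_top _ _)
  have hgre : (fun x => ((g x).re : ℂ)) = g := funext fun x =>
    Complex.ext (by simp) (by simp [him])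
  have hgi : Integrable g := by
    rw [← hgre]
    exact hfi.ofReal
  refine ⟨fun x => (g x).re, Complex.continuous_re.comp hgc, hf0, ?_, ?_⟩
  · simpa [Function.comp_def] using
      (Complex.continuous_re.tendsto _).comp (tendsto_fourierInv_cocompact (measureFourier μ))
  · have hfin : IsFiniteMeasure (volume.withDensity fun x => ENNReal.ofReal (g x).re) :=
      isFiniteMeasure_withDensity_ofReal hfi.2
    refine measure_eq_of_measureFourier_eq (funext fun ξ => ?_)
    rw [measureFourier_withDensity hfi hf0, hgre, hg]
    have hF : Integrable (𝓕 (measureFourier μ)) := by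
      have : 𝓕 (measureFourier μ) = fun x => g (-x) := funext fun x => by
        rw [hg, Real.fourierInv_eq_fourier_neg, neg_neg]
      rw [this]
      exact hgi.comp_neg
    rw [(continuous_measureFourier μ).fourier_fourierInv_eq h hF]

end LocalTimes

/-! ### Riesz potentials as inverse Fourier transforms. -/

section RieszPotential

open Real Filter Topology FourierTransform

/-- Substituting `b ↦ 1/b` turns this into Euler's Gamma integral. -/
theorem integral_rpow_mul_exp_neg_div {q a : ℝ} (hq : 0 < q) (ha : 0 < a) :
    ∫ b in Set.Ioi (0 : ℝ), b ^ (-q - 1) * rexp (-(a / b)) = a ^ (-q) * Real.Gamma q := by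
  have h := integral_comp_rpow_Ioi (fun t : ℝ => t ^ (q - 1) * rexp (-(a * t))) (p := -1) (by simp)
  rw [integral_rpow_mul_exp_neg_mul_Ioi hq ha, one_div, inv_rpow ha.le, ← rpow_neg ha.le] at h
  rw [← h]
  refine setIntegral_congr_fun measurableSet_Ioi fun b hb => ?_
  have hb : 0 < b := hb
  simp only [abs_neg, abs_one, one_mul, smul_eq_mul]
  rw [← mul_assoc, ← rpow_mul hb.le, ← rpow_add hb, rpow_neg_one, div_eq_mul_inv]
  congr 2
  ring

/-- Subordination: the Riesz kernel is a mixture of Gaussians. -/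
theorem lintegral_gaussian_eq_rieszKernel {n : ℕ} {α : ℝ} (hα : α < n)
    (x : EuclideanSpace ℝ (Fin n)) :
    ∫⁻ b in Set.Ioi (0 : ℝ),
        ENNReal.ofReal (b ^ (-((n - α) / 2) - 1) * rexp (-(π ^ 2 * ‖x‖ ^ 2 / b)))
      = ENNReal.ofReal (π ^ (α - n) * Real.Gamma ((n - α) / 2)) * rieszKernel α x := by
  have hq : 0 < (n - α) / 2 := by linarith
  have hc : 0 < π ^ (α - n) * Real.Gamma ((n - α) / 2) :=
    mul_pos (by positivity) (Real.Gamma_pos_of_pos hq)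
  rcases eq_or_ne x 0 with rfl | hx
  -- At the origin the exponential is `1` and both sides are `∞`, because no power of `b` is
  -- integrable on `(0,∞)`.
  · rw [rieszKernel, enorm_zero, ENNReal.zero_rpow_of_neg (by linarith),
      ENNReal.mul_top (by simpa using hc)]
    by_contra hne
    refine not_integrableOn_Ioi_rpow (-((n - α) / 2) - 1) ⟨by fun_prop, ?_⟩
    rw [hasFiniteIntegral_iff_ofReal]
    · simpa [lt_top_iff_ne_top] using hne
    · filter_upwards [self_mem_ae_restrict measurableSet_Ioi] with b hb
      exact rpow_nonneg (le_of_lt hb) _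
  · have hx0 : 0 < ‖x‖ := norm_pos_iff.2 hx
    have h := integral_rpow_mul_exp_neg_div hq (a := π ^ 2 * ‖x‖ ^ 2) (by positivity)
    have hpos : 0 < (π ^ 2 * ‖x‖ ^ 2) ^ (-((n - α) / 2)) * Real.Gamma ((n - α) / 2) :=
      mul_pos (by positivity) (Real.Gamma_pos_of_pos hq)
    rw [← ofReal_integral_eq_lintegral_ofReal, h, rieszKernel, ← ofReal_norm,
      ENNReal.ofReal_rpow_of_pos hx0, ← ENNReal.ofReal_mul hc.le, ← mul_pow,
      ← rpow_natCast, ← rpow_mul (by positivity), mul_rpow (by positivity) (by positivity)]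
    · congr 1
      rw [show ((2 : ℕ) : ℝ) * -((n - α) / 2) = α - n by push_cast; ring]
      ring
    -- A non-integrable function has Bochner integral `0`, whereas the value in `h` is positive.
    · by_contra hne
      rw [integral_undef hne] at h
      exact hpos.ne h
    · filter_upwards [self_mem_ae_restrict measurableSet_Ioi] with b hb
      exact mul_nonneg (rpow_nonneg (le_of_lt hb) _) (exp_nonneg _)

variable {n : ℕ}

/-- The Riesz potential of a finite measure as an inverse Fourier transform. -/
theorem rieszPotential_eq_fourierInv {α : ℝ} (hα0 : 0 < α) (hα : α < n)
    (μ : Measure (EuclideanSpace ℝ (Fin n))) [IsFiniteMeasure μ]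
    (h : Integrable fun ξ => ((‖ξ‖ ^ (-α) : ℝ) : ℂ) * measureFourier μ ξ)
    (x : EuclideanSpace ℝ (Fin n)) :
    ENNReal.ofReal (π ^ (α - n) * Real.Gamma ((n - α) / 2)) * rieszPotential α μ x
      = ENNReal.ofReal (π ^ (-(n : ℝ) / 2) * Real.Gamma (α / 2) *
          (𝓕⁻ (fun ξ => ((‖ξ‖ ^ (-α) : ℝ) : ℂ) * measureFourier μ ξ) x).re) := by
  have hn : 0 < n := by
    have : (0 : ℝ) < n := hα0.trans hα
    exact_mod_cast this
  have : Nonempty (Fin n) := ⟨⟨0, hn⟩⟩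
  have hα2 : 0 < α / 2 := by positivity
  set q : ℝ := (n - α) / 2 with hq
  -- `F` is to be integrated in both orders: over `ξ` first it gives the smoothed measure `G b`,
  -- over `b` first it gives `|ξ|^(-α)` by the Gamma integral. The exponent of `b` is `n/2 - q - 1 =
  -- α/2 - 1`.
  let F : ℝ → EuclideanSpace ℝ (Fin n) → ℂ := fun b ξ =>
    ((π ^ (-(n : ℝ) / 2) * b ^ (α / 2 - 1) : ℝ) : ℂ) *
      (Complex.exp ((2 * π * inner ℝ ξ x : ℝ) * Complex.I) *
        (Complex.exp (-b * ‖ξ‖ ^ 2) * measureFourier μ ξ))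
  let G : ℝ → ℝ := fun b => b ^ (-q - 1) * ∫ y, rexp (-(π ^ 2 * ‖x - y‖ ^ 2 / b)) ∂μ
  have hGF : ∀ b ∈ Set.Ioi (0 : ℝ), (G b : ℂ) = ∫ ξ, F b ξ := by
    intro b hb
    have hb : 0 < b := hb
    simp only [G, F]
    rw [integral_const_mul, Complex.ofReal_mul, integral_gaussian_eq_fourierInv μ hb x,
      ← mul_assoc, ← Complex.ofReal_mul, Real.fourierInv_eq']
    simp_rw [smul_eq_mul]
    congr 2
    rw [finrank_euclideanSpace_fin, div_rpow hb.le pi_pos.le, neg_div, rpow_neg pi_pos.le,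
      ← mul_div_assoc, ← rpow_add hb, div_eq_inv_mul]
    congr 2
    rw [hq]
    ring
  have hgamma : ∀ ξ : EuclideanSpace ℝ (Fin n), ξ ≠ 0 →
      ∫ b in Set.Ioi (0 : ℝ), b ^ (α / 2 - 1) * rexp (-(b * ‖ξ‖ ^ 2))
        = ‖ξ‖ ^ (-α) * Real.Gamma (α / 2) := by
    intro ξ hξ
    have hξ0 : 0 < ‖ξ‖ := norm_pos_iff.2 hξ
    have h := integral_rpow_mul_exp_neg_mul_Ioi hα2 (r := ‖ξ‖ ^ 2) (by positivity)
    simp_rw [mul_comm _ (‖ξ‖ ^ 2)]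
    rw [h, one_div, inv_rpow (by positivity), ← rpow_natCast, ← rpow_mul hξ0.le,
      rpow_neg hξ0.le]
    congr 3
    push_cast
    ring
  have hgammaI : ∀ ξ : EuclideanSpace ℝ (Fin n), ξ ≠ 0 →
      IntegrableOn (fun b : ℝ => b ^ (α / 2 - 1) * rexp (-(b * ‖ξ‖ ^ 2))) (Set.Ioi 0) := by
    intro ξ hξ
    have hξ0 : 0 < ‖ξ‖ := norm_pos_iff.2 hξ
    by_contra hne
    have h := hgamma ξ hξ
    rw [integral_undef hne] at h
    have : 0 < ‖ξ‖ ^ (-α) * Real.Gamma (α / 2) :=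
      mul_pos (by positivity) (Real.Gamma_pos_of_pos hα2)
    exact this.ne h
  have hnorm : ∀ b ∈ Set.Ioi (0 : ℝ), ∀ ξ, ‖F b ξ‖ =
      π ^ (-(n : ℝ) / 2) * ‖measureFourier μ ξ‖ * (b ^ (α / 2 - 1) * rexp (-(b * ‖ξ‖ ^ 2))) := by
    intro b hb ξ
    have hb : 0 < b := hb
    simp only [F]
    rw [norm_mul, norm_mul, norm_mul, Complex.norm_exp_ofReal_mul_I, norm_gaussian,
      Complex.norm_real, norm_of_nonneg (by positivity)]
    ring
  have hne0 : ∀ᵐ ξ : EuclideanSpace ℝ (Fin n), ξ ≠ 0 := by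
    simp [ae_iff]
  have hFm : AEStronglyMeasurable (Function.uncurry F)
      ((volume.restrict (Set.Ioi (0 : ℝ))).prod volume) := by
    have := (continuous_measureFourier μ).measurable
    apply Measurable.aestronglyMeasurable
    simp only [F, Function.uncurry_def]
    fun_prop
  -- Integrating `‖F b ξ‖` over `b` leaves a constant times `|ξ|^(-α) |μ̂(ξ)|`, so Fubini is
  -- justified exactly by `h`.
  have hFi : Integrable (Function.uncurry F)
      ((volume.restrict (Set.Ioi (0 : ℝ))).prod volume) := by
    rw [integrable_prod_iff' hFm]
    constructor
    · filter_upwards [hne0] with ξ hξ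
      have h1 := (hgammaI ξ hξ).const_mul (π ^ (-(n : ℝ) / 2) * ‖measureFourier μ ξ‖)
      refine h1.mono' ?_ ?_
      · apply Measurable.aestronglyMeasurable
        simp only [F, Function.uncurry_def]
        fun_prop
      · filter_upwards [self_mem_ae_restrict measurableSet_Ioi] with b hb
        exact (hnorm b hb ξ).le
    · refine (h.norm.const_mul (π ^ (-(n : ℝ) / 2) * Real.Gamma (α / 2))).congr ?_
      filter_upwards [hne0] with ξ hξ
      simp only [Function.uncurry_apply_pair]
      rw [setIntegral_congr_fun measurableSet_Ioi (fun b hb => hnorm b hb ξ),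
        integral_const_mul, hgamma ξ hξ, norm_mul, Complex.norm_real,
        norm_of_nonneg (by positivity)]
      ring
  have hGi : IntegrableOn G (Set.Ioi 0) := by
    have h1 : IntegrableOn (fun b => (G b : ℂ)) (Set.Ioi 0) :=
      (hFi.integral_prod_left).congr (by
        filter_upwards [self_mem_ae_restrict measurableSet_Ioi] with b hb
        exact (hGF b hb).symm)
    exact h1.re
  have hG0 : ∀ b ∈ Set.Ioi (0 : ℝ), 0 ≤ G b := fun b hb =>
    mul_nonneg (rpow_nonneg (le_of_lt hb) _) (integral_nonneg fun y => exp_nonneg _)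
  have hGint : ((∫ b in Set.Ioi (0 : ℝ), G b : ℝ) : ℂ)
      = ((π ^ (-(n : ℝ) / 2) * Real.Gamma (α / 2) : ℝ) : ℂ) *
        𝓕⁻ (fun ξ => ((‖ξ‖ ^ (-α) : ℝ) : ℂ) * measureFourier μ ξ) x := by
    rw [← integral_complex_ofReal, setIntegral_congr_fun measurableSet_Ioi hGF,
      integral_integral_swap hFi, Real.fourierInv_eq', ← integral_const_mul]
    refine integral_congr_ae ?_
    filter_upwards [hne0] with ξ hξ
    have h1 : ∀ b : ℝ, F b ξ = ((π ^ (-(n : ℝ) / 2) : ℝ) : ℂ) *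
        (Complex.exp ((2 * π * inner ℝ ξ x : ℝ) * Complex.I) * measureFourier μ ξ) *
        ((b ^ (α / 2 - 1) * rexp (-(b * ‖ξ‖ ^ 2)) : ℝ) : ℂ) := fun b => by
      simp only [F]
      push_cast
      ring_nf
    simp_rw [h1]
    rw [integral_const_mul, integral_complex_ofReal, hgamma ξ hξ, smul_eq_mul]
    push_cast
    ring
  have hGre : (∫ b in Set.Ioi (0 : ℝ), G b) = π ^ (-(n : ℝ) / 2) * Real.Gamma (α / 2) *
      (𝓕⁻ (fun ξ => ((‖ξ‖ ^ (-α) : ℝ) : ℂ) * measureFourier μ ξ) x).re := by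
    rw [← Complex.re_ofReal_mul, ← hGint, Complex.ofReal_re]
  rw [← hGre, ofReal_integral_eq_lintegral_ofReal hGi (by
    filter_upwards [self_mem_ae_restrict measurableSet_Ioi] with b hb using hG0 b hb),
    rieszPotential, ← lintegral_const_mul' _ _ ENNReal.ofReal_ne_top]
  simp_rw [hq, ← lintegral_gaussian_eq_rieszKernel hα]
  -- Tonelli in `[0,∞]`: finiteness of the potential is a consequence here, not an assumption.
  rw [lintegral_lintegral_swap (by fun_prop)]
  refine setLIntegral_congr_fun measurableSet_Ioi fun b hb => ?_
  have hb : 0 < b := hb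
  have hI : Integrable (fun y => rexp (-(π ^ 2 * ‖x - y‖ ^ 2 / b))) μ := by
    refine Integrable.of_bound (by fun_prop) 1 (Eventually.of_forall fun y => ?_)
    rw [norm_of_nonneg (exp_nonneg _), exp_le_one_iff, Left.neg_nonpos_iff]
    positivity
  simp only [G]
  rw [← integral_const_mul, ofReal_integral_eq_lintegral_ofReal (hI.const_mul _)
    (Eventually.of_forall fun y => by positivity)]

end RieszPotential

/-! ### Passage to nonnegative functions in `C₀`. -/

section ZeroAtInfinity

open Real Filter Topology FourierTransform

/-- The truncation agrees with the `ENNReal.ofReal` in the formulas for the potential and the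
density, so no sign condition on `g` is needed. -/
theorem exists_zeroAtInfty_toNNReal {V : Type*} [NormedAddCommGroup V] {g : V → ℝ}
    (hg : Continuous g) (h0 : Tendsto g (cocompact V) (𝓝 0)) :
    ∃ u : C₀(V, ℝ≥0), (∀ x, u x = (g x).toNNReal) ∧ ∃ M : ℝ≥0, ∀ x, u x ≤ M := by
  refine ⟨⟨⟨fun x => (g x).toNNReal, by fun_prop⟩, ?_⟩, fun x => rfl, ?_⟩
  · simpa [Function.comp_def] using (continuous_real_toNNReal.tendsto 0).comp h0
  · let v : C₀(V, ℝ) := ⟨⟨g, hg⟩, h0⟩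
    refine ⟨‖v.toBCF‖.toNNReal, fun x => toNNReal_le_toNNReal ?_⟩
    exact (le_abs_self _).trans (v.toBCF.norm_coe_le_norm x)

variable {n : ℕ}

theorem exists_zeroAtInfty_rieszPotential {α : ℝ} (hα0 : 0 < α) (hα : α < n)
    (μ : Measure (EuclideanSpace ℝ (Fin n))) [IsFiniteMeasure μ]
    (h : Integrable fun ξ => ((‖ξ‖ ^ (-α) : ℝ) : ℂ) * measureFourier μ ξ) :
    ∃ u : C₀(EuclideanSpace ℝ (Fin n), ℝ≥0),
      (∀ x, rieszPotential α μ x = u x) ∧ ∃ M : ℝ≥0, ∀ x, u x ≤ M := by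
  have hc : 0 < π ^ (α - n) * Real.Gamma ((n - α) / 2) :=
    mul_pos (by positivity) (Real.Gamma_pos_of_pos (by linarith))
  set c := π ^ (α - n) * Real.Gamma ((n - α) / 2) with hcdef
  set κ := π ^ (-(n : ℝ) / 2) * Real.Gamma (α / 2)
  have hcont := continuous_fourierInv h
  have hlim := tendsto_fourierInv_cocompact fun ξ : EuclideanSpace ℝ (Fin n) =>
    ((‖ξ‖ ^ (-α) : ℝ) : ℂ) * measureFourier μ ξ
  have hre := (Complex.continuous_re.tendsto _).comp hlim
  obtain ⟨u, hu, M, hM⟩ := exists_zeroAtInfty_toNNReal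
    (g := fun x => c⁻¹ * (κ * (𝓕⁻ (fun ξ : EuclideanSpace ℝ (Fin n) =>
      ((‖ξ‖ ^ (-α) : ℝ) : ℂ) * measureFourier μ ξ) x).re))
    (continuous_const.mul (continuous_const.mul (Complex.continuous_re.comp hcont)))
    (by simpa [Function.comp_def] using (hre.const_mul κ).const_mul c⁻¹)
  refine ⟨u, fun x => ?_, M, hM⟩
  have key := rieszPotential_eq_fourierInv hα0 hα μ h x
  rw [← hcdef] at key
  rw [hu]
  change _ = ENNReal.ofReal _
  rw [ENNReal.ofReal_mul (by positivity), ← key, ← mul_assoc, ← ENNReal.ofReal_mul (by positivity),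
    inv_mul_cancel₀ hc.ne', ENNReal.ofReal_one, one_mul]

theorem exists_zeroAtInfty_rnDeriv (μ : Measure (EuclideanSpace ℝ (Fin n))) [IsFiniteMeasure μ]
    (h : Integrable (measureFourier μ)) :
    μ ≪ volume ∧ ∃ L : C₀(EuclideanSpace ℝ (Fin n), ℝ≥0),
      μ.rnDeriv volume =ᵐ[volume] (fun x => (L x : ℝ≥0∞)) ∧ ∃ M : ℝ≥0, ∀ x, L x ≤ M := by
  obtain ⟨f, hfc, -, hf, hμ⟩ := exists_density_of_integrable_measureFourier μ h
  obtain ⟨u, hu, M, hM⟩ := exists_zeroAtInfty_toNNReal hfc hf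
  refine ⟨hμ ▸ withDensity_absolutelyContinuous _ _, u, ?_, M, hM⟩
  have := Measure.rnDeriv_withDensity (volume : Measure (EuclideanSpace ℝ (Fin n)))
    hfc.measurable.ennreal_ofReal
  rw [← hμ] at this
  filter_upwards [this] with x hx
  rw [hx, hu]
  rfl

end ZeroAtInfinity

/-! ### Increments of the field and the scaling estimate on the cube. -/

section FractionalBrownianField

open Real Filter Topology

variable {Ω : Type*} [MeasurableSpace Ω] {P : Measure Ω} {k n : ℕ} {H : ℝ}

theorem IsFractionalBrownianField.aemeasurable {b : orthant k → Ω → ℝ}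
    (hb : IsFractionalBrownianField H b P) (t : orthant k) : AEMeasurable (b t) P :=
  hb.isGaussianProcess.aemeasurable t

theorem IsFractionalBrownianField.map_sub_eq_gaussianReal {b : orthant k → Ω → ℝ}
    (hb : IsFractionalBrownianField H b P) (s t : orthant k) :
    P.map (fun ω => b t ω - b s ω) = gaussianReal 0 (dist t s ^ (2 * H)).toNNReal := by
  have hP := hb.isGaussianProcess.isProbabilityMeasure
  have hg : HasGaussianLaw (fun ω => b t ω - b s ω) P := hb.isGaussianProcess.hasGaussianLaw_fun_sub
  have hi : ∀ t, Integrable (b t) P := fun t =>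
    (hb.isGaussianProcess.hasGaussianLaw_eval t).integrable
  have hmean : ∫ ω, b t ω - b s ω ∂P = 0 := by
    rw [integral_sub (hi t) (hi s), hb.centered, hb.centered, sub_zero]
  rw [hg.map_eq_gaussianReal, hmean, variance_of_integral_eq_zero hg.aemeasurable hmean,
    ← hb.increments s t]
  simp_rw [sq_abs]

/-- The coordinates of the increment are independent centered Gaussians of variance `dist t s ^ (2 *
H)`, so the characteristic function factorizes. -/
theorem IsFractionalBrownianVectorField.integral_exp_inner_sub [IsProbabilityMeasure P]
    {B : orthant k → Ω → EuclideanSpace ℝ (Fin n)} (hB : IsFractionalBrownianVectorField H B P)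
    (s t : orthant k) (η : EuclideanSpace ℝ (Fin n)) :
    ∫ ω, Complex.exp (inner ℝ (B t ω - B s ω) η * Complex.I) ∂P
      = (rexp (-(‖η‖ ^ 2 * dist t s ^ (2 * H) / 2)) : ℝ) := by
  have hm : ∀ (i : Fin n) t, AEMeasurable (fun ω => B t ω i) P := fun i t =>
    (hB.component i).aemeasurable t
  have hmd : ∀ i : Fin n, AEMeasurable (fun ω => B t ω i - B s ω i) P := fun i =>
    (hm i t).sub (hm i s)
  have hind : iIndepFun (fun (i : Fin n) ω => B t ω i - B s ω i) P :=
    hB.indep.comp (fun _ f => f t - f s)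
      fun _ => (measurable_pi_apply t).sub (measurable_pi_apply s)
  have h := (iIndepFun_iff_charFun_pi hmd).1 hind η
  have hv : AEMeasurable (fun ω => WithLp.toLp 2 fun i => B t ω i - B s ω i) P :=
    (WithLp.measurable_toLp 2 _).comp_aemeasurable (aemeasurable_pi_lambda _ hmd)
  rw [charFun_apply, integral_map hv (by fun_prop)] at h
  have e : ∀ ω, (WithLp.toLp 2 fun i => B t ω i - B s ω i) = B t ω - B s ω := fun ω => by
    ext i
    simp
  simp_rw [e] at h
  rw [h]
  simp_rw [(hB.component _).map_sub_eq_gaussianReal s t, charFun_gaussianReal]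
  rw [← Complex.exp_sum, EuclideanSpace.norm_sq_eq, Complex.ofReal_exp]
  congr 1
  rw [Real.coe_toNNReal _ (by positivity), Finset.sum_mul, Finset.sum_div]
  push_cast
  rw [← Finset.sum_neg_distrib]
  refine Finset.sum_congr rfl fun i _ => ?_
  simp only [norm_eq_abs, mul_zero, zero_mul, zero_sub, neg_inj]
  rw [← Complex.ofReal_pow, ← Complex.ofReal_pow, sq_abs]
  ring

theorem measurableSet_unitCube (k : ℕ) : MeasurableSet (unitCube k) := by
  have : unitCube k = ⋂ i, {t : EuclideanSpace ℝ (Fin k) | 0 ≤ t i ∧ t i ≤ 1} := by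
    ext t
    simp [unitCube]
  rw [this]
  refine MeasurableSet.iInter fun i => IsClosed.measurableSet ?_
  have h : Continuous fun t : EuclideanSpace ℝ (Fin k) => t i := by fun_prop
  exact (isClosed_le continuous_const h).inter (isClosed_le h continuous_const)

instance isFiniteMeasure_cubeVolume (k : ℕ) : IsFiniteMeasure (cubeVolume k) := by
  refine ⟨?_⟩
  rw [cubeVolume, comap_subtype_coe_apply (measurableSet_unitCube k)]
  refine (Metric.isBounded_iff_subset_closedBall 0 |>.2 ⟨√k, fun t ht => ?_⟩).measure_lt_top
  obtain ⟨x, -, rfl⟩ := ht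
  rw [mem_closedBall_zero_iff, EuclideanSpace.norm_eq]
  refine sqrt_le_sqrt ?_
  calc ∑ i, ‖(x : EuclideanSpace ℝ (Fin k)) i‖ ^ 2 ≤ ∑ _i : Fin k, (1 : ℝ) := by
        refine Finset.sum_le_sum fun i _ => ?_
        have := x.2 i
        rw [norm_of_nonneg this.1]
        nlinarith
    _ = k := by simp

theorem integrable_exp_neg_norm_rpow (hk : 1 ≤ k) (hH : 0 < H) :
    Integrable fun u : EuclideanSpace ℝ (Fin k) => rexp (-(‖u‖ ^ (2 * H) / 2)) := by
  have : Nonempty (Fin k) := ⟨⟨0, hk⟩⟩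
  rw [integrable_fun_norm_addHaar (volume : Measure (EuclideanSpace ℝ (Fin k)))
    (f := fun r => rexp (-(r ^ (2 * H) / 2))), finrank_euclideanSpace_fin]
  have h := integrableOn_rpow_mul_exp_neg_mul_rpow (p := 2 * H) (s := (k - 1 : ℕ)) (b := 1 / 2)
    (by have : (0 : ℝ) ≤ (k - 1 : ℕ) := by positivity
        linarith) (by positivity) (by norm_num)
  refine h.congr_fun (fun y _ => ?_) measurableSet_Ioi
  simp only [rpow_natCast, smul_eq_mul]
  ring_nf

/-- Enlarging the cube to the whole space makes the bound uniform in `s`; the change of variables `u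
= r^(1/H) (t - s)` then contributes the Jacobian `r^(-k/H)`. -/
theorem exists_lintegral_exp_dist_le (hk : 1 ≤ k) (hH : 0 < H) :
    ∃ C : ℝ, 0 ≤ C ∧ ∀ r : ℝ, 0 < r → ∀ s : EuclideanSpace ℝ (Fin k),
      ∫ t : unitCube k, rexp (-(r ^ 2 * dist (t : EuclideanSpace ℝ (Fin k)) s ^ (2 * H) / 2))
        ∂cubeVolume k ≤ C * r ^ (-(k / H)) := by
  refine ⟨∫ u : EuclideanSpace ℝ (Fin k), rexp (-(‖u‖ ^ (2 * H) / 2)),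
    integral_nonneg fun u => exp_nonneg _, fun r hr s => ?_⟩
  have hR : 0 < r ^ H⁻¹ := by positivity
  have e : ∀ u : EuclideanSpace ℝ (Fin k),
      rexp (-(r ^ 2 * dist u s ^ (2 * H) / 2)) = rexp (-(‖r ^ H⁻¹ • (u - s)‖ ^ (2 * H) / 2)) := by
    intro u
    rw [norm_smul, norm_of_nonneg hR.le, mul_rpow hR.le (norm_nonneg _), ← rpow_mul hr.le,
      dist_eq_norm, ← rpow_natCast]
    congr 5
    push_cast
    field_simp
  have hi := integrable_exp_neg_norm_rpow hk hH
  have hi' : Integrable fun u : EuclideanSpace ℝ (Fin k) =>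
      rexp (-(r ^ 2 * dist u s ^ (2 * H) / 2)) := by
    simp_rw [e]
    exact (hi.comp_smul hR.ne').comp_sub_right s
  calc ∫ t : unitCube k, rexp (-(r ^ 2 * dist (t : EuclideanSpace ℝ (Fin k)) s ^ (2 * H) / 2))
        ∂cubeVolume k
      = ∫ u in unitCube k, rexp (-(r ^ 2 * dist u s ^ (2 * H) / 2)) :=
        integral_subtype_comap (measurableSet_unitCube k)
          fun u => rexp (-(r ^ 2 * dist u s ^ (2 * H) / 2))
    _ ≤ ∫ u, rexp (-(r ^ 2 * dist u s ^ (2 * H) / 2)) :=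
        setIntegral_le_integral hi' (Eventually.of_forall fun u => exp_nonneg _)
    _ = ∫ u, rexp (-(‖r ^ H⁻¹ • u‖ ^ (2 * H) / 2)) := by
        simp_rw [e]
        exact integral_sub_right_eq_self (μ := (volume : Measure (EuclideanSpace ℝ (Fin k))))
          (fun u => rexp (-(‖r ^ H⁻¹ • u‖ ^ (2 * H) / 2))) s
    _ = _ := by
        rw [Measure.integral_comp_smul_of_nonneg volume
          (fun u => rexp (-(‖u‖ ^ (2 * H) / 2))) _ (hR := hR.le), finrank_euclideanSpace_fin,
          smul_eq_mul, mul_comm, ← rpow_natCast, ← rpow_mul hr.le, ← rpow_neg hr.le]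
        congr 3
        ring

end FractionalBrownianField

/-! ### Second moments of random characteristic functions. -/

section SecondMoment

open Real Filter Topology

variable {Ω T E : Type*} [MeasurableSpace Ω] [MeasurableSpace T] [NormedAddCommGroup E]
  [InnerProductSpace ℝ E] [MeasurableSpace E] [BorelSpace E] [SecondCountableTopology E]

theorem charFun_map_eq_integral {D : Measure T} {X : T → E} (hX : Measurable X) (η : E) :
    charFun (D.map X) η = ∫ t, Complex.exp (inner ℝ (X t) η * Complex.I) ∂D := by
  rw [charFun_apply, integral_map hX.aemeasurable (by fun_prop)]

/-- Second moment of the characteristic function of a random occupation measure. -/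
theorem integral_normSq_charFun_map (P : Measure Ω) [IsProbabilityMeasure P] (D : Measure T)
    [IsFiniteMeasure D] {X : Ω × T → E} (hX : Measurable X) (η : E) :
    ((∫ ω, ‖charFun (D.map fun t => X (ω, t)) η‖ ^ 2 ∂P : ℝ) : ℂ)
      = ∫ p, ∫ ω, Complex.exp (inner ℝ (X (ω, p.1) - X (ω, p.2)) η * Complex.I) ∂P ∂(D.prod D) := by
  rw [integral_integral_swap, ← integral_complex_ofReal]
  · refine integral_congr_ae (Eventually.of_forall fun ω => ?_)
    simp only
    have hω : Measurable fun t => X (ω, t) := hX.comp measurable_prodMk_left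
    rw [Complex.ofReal_pow, ← Complex.mul_conj', charFun_map_eq_integral hω, ← integral_conj,
      ← integral_prod_mul]
    refine integral_congr_ae (Eventually.of_forall fun p => ?_)
    simp only
    rw [← Complex.exp_conj, ← Complex.exp_add, inner_sub_left]
    congr 1
    simp only [map_mul, Complex.conj_ofReal, Complex.conj_I]
    push_cast
    ring
  · refine Integrable.of_bound (C := 1) ?_ (Eventually.of_forall fun p => ?_)
    · apply Measurable.aestronglyMeasurable
      simp only [Function.uncurry_def]
      fun_prop
    · simp only [Function.uncurry_def, Complex.norm_exp_ofReal_mul_I, le_refl]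

end SecondMoment

/-! ### Almost sure integrability for the occupation measure. -/

section OccupationMeasure

open Real Filter Topology

variable {Ω : Type*} [MeasurableSpace Ω] {P : Measure Ω} {k n : ℕ} {H : ℝ}

/-- Letting `η` vary with `ω` gives joint measurability in `(ω, ξ)`, by taking `Ω' = Ω × ℝⁿ`. -/
theorem measurable_charFun_map {E T Ω' : Type*} [MeasurableSpace T] [MeasurableSpace Ω']
    [NormedAddCommGroup E] [InnerProductSpace ℝ E] [MeasurableSpace E] [BorelSpace E]
    [SecondCountableTopology E] {D : Measure T} [SFinite D] {X : Ω' × T → E} (hX : Measurable X)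
    {η : Ω' → E} (hη : Measurable η) :
    Measurable fun ω => charFun (D.map fun t => X (ω, t)) (η ω) := by
  have e : ∀ ω, charFun (D.map fun t => X (ω, t)) (η ω)
      = ∫ t, Complex.exp (inner ℝ (X (ω, t)) (η ω) * Complex.I) ∂D := fun ω =>
    charFun_map_eq_integral (hX.comp measurable_prodMk_left) _
  simp_rw [e]
  refine (StronglyMeasurable.integral_prod_right' (f := fun p : Ω' × T =>
    Complex.exp (inner ℝ (X p) (η p.1) * Complex.I)) ?_).measurable
  exact Measurable.stronglyMeasurable (by fun_prop)

/-- The second moment is at most `C m |η|^(-k/H)`, where `m` is the mass of the cube. Agreement of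
`X` with the field at almost every time suffices, as only the laws of increments for almost every
pair of times enter. -/
theorem exists_lintegral_charFun_le [IsProbabilityMeasure P] (hk : 1 ≤ k) (hH : 0 < H)
    {B : orthant k → Ω → EuclideanSpace ℝ (Fin n)} (hB : IsFractionalBrownianVectorField H B P)
    {X : Ω × unitCube k → EuclideanSpace ℝ (Fin n)} (hX : Measurable X)
    (hXB : ∀ᵐ t ∂cubeVolume k, ∀ᵐ ω ∂P, cubePath B ω t = X (ω, t)) :
    ∃ A : ℝ, 0 ≤ A ∧ ∀ η : EuclideanSpace ℝ (Fin n), η ≠ 0 →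
      ∫⁻ ω, ‖charFun ((cubeVolume k).map fun t => X (ω, t)) η‖ₑ ∂P
        ≤ ENNReal.ofReal (A * min 1 (‖η‖ ^ (-(k / (2 * H))))) := by
  obtain ⟨C, hC, hCle⟩ := exists_lintegral_exp_dist_le hk hH
  set D := cubeVolume k with hD
  set m := D.real Set.univ
  have hm : 0 ≤ m := measureReal_nonneg
  refine ⟨m + (1 + C * m) / 2, by positivity, fun η hη => ?_⟩
  have hη0 : 0 < ‖η‖ := norm_pos_iff.2 hη
  set lam : ℝ := ‖η‖ ^ (-(k / (2 * H))) with hlam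
  have hlam0 : 0 < lam := by positivity
  have hlam2 : ‖η‖ ^ (-(k / H)) = lam ^ 2 := by
    rw [hlam, ← rpow_natCast, ← rpow_mul hη0.le]
    congr 1
    push_cast
    field_simp
  have hφm : Measurable fun ω => charFun (D.map fun t => X (ω, t)) η :=
    measurable_charFun_map hX measurable_const
  have hφle : ∀ ω, ‖charFun (D.map fun t => X (ω, t)) η‖ ≤ m := fun ω => by
    refine (norm_charFun_le _).trans_eq ?_
    have hω : Measurable fun t => X (ω, t) := hX.comp measurable_prodMk_left
    rw [measureReal_def, Measure.map_apply hω MeasurableSet.univ]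
    rfl
  have hsecond : ∫ ω, ‖charFun (D.map fun t => X (ω, t)) η‖ ^ 2 ∂P ≤ C * m * lam ^ 2 := by
    have h := integral_normSq_charFun_map P D hX η
    have hae : ∀ᵐ p ∂(D.prod D),
        ∫ ω, Complex.exp (inner ℝ (X (ω, p.1) - X (ω, p.2)) η * Complex.I) ∂P
          = (rexp (-(‖η‖ ^ 2 * dist (p.1 : EuclideanSpace ℝ (Fin k)) p.2 ^ (2 * H) / 2)) : ℝ) := by
      have h1 : ∀ᵐ p ∂(D.prod D), ∀ᵐ ω ∂P, cubePath B ω p.1 = X (ω, p.1) :=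
        Measure.quasiMeasurePreserving_fst.ae hXB
      have h2 : ∀ᵐ p ∂(D.prod D), ∀ᵐ ω ∂P, cubePath B ω p.2 = X (ω, p.2) :=
        Measure.quasiMeasurePreserving_snd.ae hXB
      filter_upwards [h1, h2] with p hp1 hp2
      refine Eq.trans ?_ (hB.integral_exp_inner_sub
        (Set.inclusion (unitCube_subset_orthant k) p.2)
        (Set.inclusion (unitCube_subset_orthant k) p.1) η)
      refine integral_congr_ae ?_
      filter_upwards [hp1, hp2] with ω hω1 hω2
      rw [← hω1, ← hω2]
      rfl
    rw [integral_congr_ae hae, integral_complex_ofReal, Complex.ofReal_inj] at h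
    rw [h, integral_prod_symm]
    · calc _ ≤ ∫ _s : unitCube k, C * lam ^ 2 ∂D := by
            refine integral_mono_of_nonneg
              (Eventually.of_forall fun s => integral_nonneg fun t => exp_nonneg _)
              (integrable_const _) (Eventually.of_forall fun s => ?_)
            rw [← hlam2]
            exact hCle ‖η‖ hη0 s
        _ = C * m * lam ^ 2 := by
            rw [integral_const, smul_eq_mul]
            ring
    · refine Integrable.of_bound (C := 1) ?_ (Eventually.of_forall fun p => ?_)
      · exact Measurable.aestronglyMeasurable (by fun_prop)
      · rw [norm_of_nonneg (exp_nonneg _), exp_le_one_iff, Left.neg_nonpos_iff]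
        positivity
  have hφi : Integrable (fun ω => charFun (D.map fun t => X (ω, t)) η) P :=
    Integrable.of_bound hφm.aestronglyMeasurable m (Eventually.of_forall hφle)
  have hφ2i : Integrable (fun ω => ‖charFun (D.map fun t => X (ω, t)) η‖ ^ 2) P := by
    refine Integrable.of_bound (C := m ^ 2) (hφm.norm.pow_const 2).aestronglyMeasurable
      (Eventually.of_forall fun ω => ?_)
    rw [norm_pow, norm_norm]
    exact pow_le_pow_left₀ (norm_nonneg _) (hφle ω) 2
  have hfirst : ∫ ω, ‖charFun (D.map fun t => X (ω, t)) η‖ ∂P ≤ m := by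
    calc _ ≤ ∫ _ω, m ∂P := integral_mono hφi.norm (integrable_const _) hφle
      _ = m := by simp
  have hfirst' : ∫ ω, ‖charFun (D.map fun t => X (ω, t)) η‖ ∂P ≤ (1 + C * m) / 2 * lam := by
    -- This replaces Cauchy-Schwarz by `z ≤ λ/2 + z²/(2λ)`; with `λ = |η|^(-k/(2H))` both terms have
    -- order `λ` in expectation.
    calc _ ≤ ∫ ω, (lam / 2 + (2 * lam)⁻¹ * ‖charFun (D.map fun t => X (ω, t)) η‖ ^ 2) ∂P := by
          refine integral_mono hφi.norm ((integrable_const _).add (hφ2i.const_mul _)) fun ω => ?_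
          simp only
          set z := ‖charFun (D.map fun t => X (ω, t)) η‖
          have : lam / 2 + (2 * lam)⁻¹ * z ^ 2 - z = (2 * lam)⁻¹ * (lam - z) ^ 2 := by
            field_simp
            ring
          have h0 : 0 ≤ (2 * lam)⁻¹ * (lam - z) ^ 2 := by positivity
          linarith
      _ = lam / 2 + (2 * lam)⁻¹ * ∫ ω, ‖charFun (D.map fun t => X (ω, t)) η‖ ^ 2 ∂P := by
          rw [integral_add (integrable_const _) (hφ2i.const_mul _), integral_const_mul]
          simp
      _ ≤ lam / 2 + (2 * lam)⁻¹ * (C * m * lam ^ 2) := by gcongr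
      _ = (1 + C * m) / 2 * lam := by
          field_simp
  rw [← ofReal_integral_norm_eq_lintegral_enorm hφi]
  refine ENNReal.ofReal_le_ofReal ?_
  rw [mul_min_of_nonneg _ _ (by positivity), mul_one]
  refine le_min (hfirst.trans ?_) (hfirst'.trans ?_)
  · have : 0 ≤ C * m := by positivity
    linarith
  · have : 0 ≤ m * lam := by positivity
    linarith

/-- In polar coordinates the integrand is at most `r^(n-1-α)` near `0` and `r^(n-1-α-β)` near
infinity; the two hypotheses on `α` are the convergence conditions. -/
theorem integrable_rpow_norm_mul_min {α β : ℝ} (hn : 1 ≤ n) (hα : α < n) (hβ : n - β < α) :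
    Integrable fun ξ : EuclideanSpace ℝ (Fin n) => ‖ξ‖ ^ (-α) * min 1 (‖ξ‖ ^ (-β)) := by
  have : Nonempty (Fin n) := ⟨⟨0, hn⟩⟩
  rw [integrable_fun_norm_addHaar (volume : Measure (EuclideanSpace ℝ (Fin n)))
    (f := fun r => r ^ (-α) * min 1 (r ^ (-β))), finrank_euclideanSpace_fin,
    ← Set.Ioc_union_Ioi_eq_Ioi zero_le_one]
  have hcast : ((n - 1 : ℕ) : ℝ) = n - 1 := by push_cast [hn]; ring
  have hm : Measurable fun y : ℝ => y ^ (n - 1) • (y ^ (-α) * min 1 (y ^ (-β))) := by fun_prop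
  refine IntegrableOn.union ?_ ?_
  · have h := (intervalIntegral.intervalIntegrable_rpow' (a := 0) (b := 1)
      (r := n - 1 - α) (by linarith)).1
    refine h.mono' hm.aestronglyMeasurable ?_
    filter_upwards [self_mem_ae_restrict measurableSet_Ioc] with y hy
    have hy0 : 0 < y := hy.1
    rw [norm_of_nonneg (by positivity), smul_eq_mul]
    calc y ^ (n - 1) * (y ^ (-α) * min 1 (y ^ (-β))) ≤ y ^ (n - 1) * (y ^ (-α) * 1) := by
          gcongr
          exact min_le_left _ _
      _ = y ^ (n - 1 - α) := by
          rw [mul_one, ← rpow_natCast, ← rpow_add hy0, hcast, ← sub_eq_add_neg]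
  · have h := integrableOn_Ioi_rpow_of_lt (a := n - 1 - α - β) (by linarith) zero_lt_one
    refine h.mono' hm.aestronglyMeasurable ?_
    filter_upwards [self_mem_ae_restrict measurableSet_Ioi] with y hy
    have hy0 : 0 < y := zero_lt_one.trans hy
    rw [norm_of_nonneg (by positivity), smul_eq_mul]
    calc y ^ (n - 1) * (y ^ (-α) * min 1 (y ^ (-β))) ≤ y ^ (n - 1) * (y ^ (-α) * y ^ (-β)) := by
          gcongr
          exact min_le_right _ _
      _ = y ^ (n - 1 - α - β) := by
          rw [← rpow_natCast, ← rpow_add hy0, ← rpow_add hy0, hcast]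
          congr 1
          ring

instance isFiniteMeasure_occupationMeasure (X : unitCube k → EuclideanSpace ℝ (Fin n)) :
    IsFiniteMeasure (occupationMeasure X) := by
  unfold occupationMeasure
  infer_instance

/-- Almost surely, the Fourier transform of the occupation measure is integrable against
`‖ξ‖ ^ (-α)`. -/
theorem ae_integrable_measureFourier_occupationMeasure [IsProbabilityMeasure P] (hk : 1 ≤ k)
    (hn : 1 ≤ n) (hH : 0 < H) {B : orthant k → Ω → EuclideanSpace ℝ (Fin n)}
    (hB : IsFractionalBrownianVectorField H B P)
    (hBmeas : AEMeasurable (fun p : Ω × unitCube k => cubePath B p.1 p.2) (P.prod (cubeVolume k)))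
    {α : ℝ} (hα : α < n) (hkα : (n : ℝ) - k / (2 * H) < α) :
    ∀ᵐ ω ∂P, AEMeasurable (cubePath B ω) (cubeVolume k) ∧
      Integrable fun ξ : EuclideanSpace ℝ (Fin n) =>
        ((‖ξ‖ ^ (-α) : ℝ) : ℂ) * measureFourier (occupationMeasure (cubePath B ω)) ξ := by
  -- The jointly measurable modification `X` is used through both families of slices: for almost
  -- every `ω` it has the same occupation measure, and for almost every `t` the same law as the
  -- field.
  set X := hBmeas.mk _ with hXdef
  have hX : Measurable X := hBmeas.measurable_mk
  have hae := hBmeas.ae_eq_mk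
  rw [← hXdef] at hae
  have hω : ∀ᵐ ω ∂P, ∀ᵐ t ∂cubeVolume k, cubePath B ω t = X (ω, t) :=
    Measure.ae_ae_of_ae_prod hae
  have ht : ∀ᵐ t ∂cubeVolume k, ∀ᵐ ω ∂P, cubePath B ω t = X (ω, t) :=
    Measure.ae_ae_of_ae_prod (Measure.measurePreserving_swap.quasiMeasurePreserving.ae hae)
  obtain ⟨A, hA, hbound⟩ := exists_lintegral_charFun_le hk hH hB hX ht
  let W : Ω × EuclideanSpace ℝ (Fin n) → ℂ := fun p =>
    ((‖p.2‖ ^ (-α) : ℝ) : ℂ) *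
      measureFourier ((cubeVolume k).map fun t => X (p.1, t)) p.2
  have hW : Measurable W := by
    refine Measurable.mul (by fun_prop) ?_
    exact measurable_charFun_map (Ω' := Ω × EuclideanSpace ℝ (Fin n))
      (X := fun q => X (q.1.1, q.2)) (by fun_prop) (η := fun p => -(2 * π) • p.2) (by fun_prop)
  have hne0 : ∀ᵐ ξ : EuclideanSpace ℝ (Fin n), ξ ≠ 0 := by
    have : Nonempty (Fin n) := ⟨⟨0, hn⟩⟩
    simp [ae_iff]
  have hfin : ∫⁻ ω, (∫⁻ ξ, ‖W (ω, ξ)‖ₑ) ∂P < ∞ := by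
    rw [lintegral_lintegral_swap hW.enorm.aemeasurable]
    have hI := (integrable_rpow_norm_mul_min hn hα hkα).const_mul A
    refine lt_of_le_of_lt (lintegral_mono_ae ?_) hI.lintegral_lt_top
    filter_upwards [hne0] with ξ hξ
    have hξ0 : 0 < ‖ξ‖ := norm_pos_iff.2 hξ
    have h2π : 1 ≤ 2 * π := by linarith [pi_gt_three]
    have hb := hbound (-(2 * π) • ξ) (by simp [hξ, pi_ne_zero])
    -- The factor `2π` only enlarges the argument, and the bound decreases in the norm, so the
    -- factor can be dropped.
    have hnorm : ‖ξ‖ ≤ ‖-(2 * π) • ξ‖ := by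
      rw [norm_smul, norm_neg, norm_of_nonneg (by positivity)]
      exact le_mul_of_one_le_left hξ0.le h2π
    have hβ : (0 : ℝ) ≤ k / (2 * H) := by positivity
    simp only [W, enorm_mul]
    rw [lintegral_const_mul' _ _ enorm_ne_top]
    calc _ ≤ ‖((‖ξ‖ ^ (-α) : ℝ) : ℂ)‖ₑ *
          ENNReal.ofReal (A * min 1 (‖-(2 * π) • ξ‖ ^ (-(k / (2 * H))))) := by
          gcongr
          exact hb
      _ ≤ ‖((‖ξ‖ ^ (-α) : ℝ) : ℂ)‖ₑ *
          ENNReal.ofReal (A * min 1 (‖ξ‖ ^ (-(k / (2 * H))))) := by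
          gcongr _ * ENNReal.ofReal (A * min 1 ?_)
          exact rpow_le_rpow_of_nonpos hξ0 hnorm (neg_nonpos.2 hβ)
      _ = ENNReal.ofReal (A * (‖ξ‖ ^ (-α) * min 1 (‖ξ‖ ^ (-(k / (2 * H)))))) := by
          rw [← ofReal_norm, Complex.norm_real, norm_of_nonneg (by positivity),
            ← ENNReal.ofReal_mul (by positivity)]
          congr 1
          ring
  have hfin' := ae_lt_top hW.enorm.lintegral_prod_right' hfin.ne
  filter_upwards [hω, hfin'] with ω hω1 hω2
  refine ⟨⟨fun t => X (ω, t), by fun_prop, hω1⟩, ?_⟩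
  have e : occupationMeasure (cubePath B ω) = (cubeVolume k).map fun t => X (ω, t) :=
    Measure.map_congr hω1
  rw [e]
  exact ⟨(hW.comp measurable_prodMk_left).aestronglyMeasurable, hω2⟩

theorem exists_measurableSet_of_ae [IsProbabilityMeasure P] {p : Ω → Prop} (h : ∀ᵐ ω ∂P, p ω) :
    ∃ Ω₀ : Set Ω, MeasurableSet Ω₀ ∧ P Ω₀ = 1 ∧ ∀ ω ∈ Ω₀, p ω := by
  obtain ⟨s, hs, hsm, hs0⟩ := exists_measurable_superset_of_null (ae_iff.1 h)
  refine ⟨sᶜ, hsm.compl, (prob_compl_eq_one_iff hsm).2 hs0, fun ω hω => ?_⟩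
  by_contra hp
  exact hω (hs hp)

end OccupationMeasure

end

theorem lemmaL {Ω : Type*} [MeasurableSpace Ω] (P : Measure Ω) [IsProbabilityMeasure P]
    (k n : ℕ) (hk : 1 ≤ k) (hn : 1 ≤ n) (H : ℝ) (hH0 : 0 < H) (hH1 : H < 1)
    (B : orthant k → Ω → EuclideanSpace ℝ (Fin n))
    (hB : IsFractionalBrownianVectorField H B P)
    (hBmeas : AEMeasurable (fun p : Ω × unitCube k => cubePath B p.1 p.2) (P.prod (cubeVolume k))) :
    (∀ α : ℝ, 0 < α → (n : ℝ) - k / (2 * H) < α → α < n →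
      ∃ Ω₀ : Set Ω, MeasurableSet Ω₀ ∧ P Ω₀ = 1 ∧ ∀ ω ∈ Ω₀,
        AEMeasurable (cubePath B ω) (cubeVolume k) ∧
        ∃ u : C₀(EuclideanSpace ℝ (Fin n), ℝ≥0),
          (∀ x, rieszPotential α (occupationMeasure (cubePath B ω)) x = u x) ∧
          ∃ M : ℝ≥0, ∀ x, u x ≤ M) ∧
    ((n : ℝ) < k / (2 * H) →
      ∃ Ω₀ : Set Ω, MeasurableSet Ω₀ ∧ P Ω₀ = 1 ∧ ∀ ω ∈ Ω₀,
        AEMeasurable (cubePath B ω) (cubeVolume k) ∧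
        HasLocalTimes (cubePath B ω) ∧
        ∃ L : C₀(EuclideanSpace ℝ (Fin n), ℝ≥0),
          localTime (cubePath B ω) =ᵐ[volume] (fun x => (L x : ℝ≥0∞)) ∧
          ∃ M : ℝ≥0, ∀ x, L x ≤ M) := by
  refine ⟨fun α hα0 hkα hα => exists_measurableSet_of_ae ?_,
    fun h => exists_measurableSet_of_ae ?_⟩
  · filter_upwards [ae_integrable_measureFourier_occupationMeasure hk hn hH0 hB hBmeas hα hkα]
      with ω hω
    exact ⟨hω.1, exists_zeroAtInfty_rieszPotential hα0 hα _ hω.2⟩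
  -- Local times are the case `α = 0`, where the weight `‖ξ‖ ^ (-α)` is identically `1`, also at the
  -- origin.
  · filter_upwards [ae_integrable_measureFourier_occupationMeasure hk hn hH0 hB hBmeas
      (α := 0) (by exact_mod_cast hn) (by linarith)] with ω hω
    exact ⟨hω.1, exists_zeroAtInfty_rnDeriv _ (by simpa using hω.2)⟩
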